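/- Let $\mathbb K=\mathbb R$ or $\mathbb C$. Consider the broadcast channel with a transmitter with two antennas and two single-antenna users. User $k\in\{1,2\}$ receives at time $t=0,1,2,\dots$ $$y^{[k]}(t)=h^{[k]}_1(t)\,x_1(t)+h^{[k]}_2(t)\,x_2(t)+z^{[k]}(t),$$ where the noise is additive, white, Gaussian, of unit variance, over $\mathbb K$, and the input has average power at most $P$. The fading is staggered block fading with coherence time $T=2$: user 1's channel vector $h^{[1]}\in\mathbb K^2$ may change its value only after the times $0,2,4,\dots$, and user 2's vector $h^{[2]}$ only after the times $1,3,5,\dots$. For each user, the sequence of channel vectors in successive blocks is stationary, and the joint distribution of the vectors in two successive blocks is absolutely continuous; no independence (across blocks, antennas or users) is assumed. Each receiver knows its own channel vectors perfectly. The transmitter knows no channel values, only the fading structure and the statistics. Then, almost surely, a total of $\frac43$ degrees of freedom (DoF) is achievable. More precisely, the DoF pair $(\frac23,\frac23)$ is achievable: there are rates $R_k(P)$, $k=1,2$, with $$\lim_{P\to\infty}\frac{R_k(P)}{\frac{\dim_{\mathbb R}\mathbb K}{2}\log P}=\frac23,$$ and, for every $P>0$ and every block length $n$, a code which satisfies the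 power constraint $P$, does not depend on the channel realization and, for all sufficiently large $n$, has rates at least $R_k(P)$, such that for almost every channel realization and all sufficiently large $P$ (how large may depend on the realization) the error probability of each user tends to $0$ as $n\to\infty$. Moreover, this holds with codes that use channel-independent linear beamforming over supersymbols of three symbols, i.e. over the times $3i,3i+1,3i+2$. The six inputs $(x_1(3i),x_2(3i),x_1(3i+1),x_2(3i+1),x_1(3i+2),x_2(3i+2))^{\mathsf T}$ are $$\begin{pmatrix}I\\I\\0\end{pmatrix}u^{[1]}+\begin{pmatrix}0\\I\\I\end{pmatrix}u^{[2]}\quad(i\text{ even}),\qquad \begin{pmatrix}0\\I\\I\end{pmatrix}u^{[1]}+\begin{pmatrix}I\\I\\0\end{pmatrix}u^{[2]}\quad(i\text{ odd}),$$ where $I$ is the $2\times2$ identity matrix and the pair of streams $u^{[k]}\in\mathbb K^2$ depends only on user $k$'s message (and on $i$). So each user gets $2$ DoF per supersymbol. -/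

import Mathlib

open MeasureTheory ProbabilityTheory Filter Topology
open scoped ENNReal NNReal

namespace StaggeredBC

noncomputable section

/-- The fading block that user `k` is in at time `t = 0, 1, 2, …`, for coherence time `2`.
Both users' channels are constant over blocks of two symbols, and the block boundaries of the two
users are staggered by one symbol: user `0` changes state after times `0, 2, 4, …`, user `1` after
times `1, 3, 5, …`. -/
def blockIndex (k : Fin 2) (t : ℕ) : ℕ :=
  if k = 0 then (t + 1) / 2 else t / 2

/-- Unit-variance additive white Gaussian noise: `N(0,1)` if `𝕜 = ℝ` (where `RCLike.I = 0`), and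
circularly symmetric complex `CN(0,1)` if `𝕜 = ℂ`. -/
def awgn (𝕜 : Type*) [RCLike 𝕜] : Measure 𝕜 :=
  ((gaussianReal 0 ((Module.finrank ℝ 𝕜 : ℝ≥0)⁻¹)).prod
    (gaussianReal 0 ((Module.finrank ℝ 𝕜 : ℝ≥0)⁻¹))).map
      (fun p : ℝ × ℝ => (p.1 : 𝕜) + (p.2 : 𝕜) * RCLike.I)

/-- A staggered block fading process with generic states: `h k j ω a` is the coefficient from
transmit antenna `a` to user `k` in the `j`-th fading block of user `k`.
For each user the process of block states is stationary, and the joint law of the states of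
two successive blocks is absolutely continuous. Neither independence across blocks,
antennas or users nor ergodicity is required. -/
structure IsGenericBlockFading {𝕜 : Type*} [RCLike 𝕜] {Ω : Type*} [MeasurableSpace Ω]
    (μ : Measure Ω) (h : Fin 2 → ℕ → Ω → Fin 2 → 𝕜) : Prop where
  measurable : ∀ k j, Measurable (h k j)
  stationary : ∀ k, μ.map (fun ω (j : ℕ) => h k (j + 1) ω) = μ.map (fun ω (j : ℕ) => h k j ω)
  generic : ∀ k j, μ.map (fun ω => (h k j ω, h k (j + 1) ω)) ≪
    (Measure.addHaar : Measure ((Fin 2 → 𝕜) × (Fin 2 → 𝕜)))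

/-- A code of block length `n` for the broadcast channel with two transmit antennas and two
single-antenna users. The encoder does not see the channel; decoder `k` is given the
channel vectors of user `k` at the times `0, …, n-1` and the received signal of user `k`. -/
structure Code (𝕜 : Type*) [RCLike 𝕜] (n : ℕ) where
  /-- number of messages for each user -/
  card : Fin 2 → ℕ
  card_pos : ∀ k, 0 < card k
  /-- signal sent at each time from each antenna -/
  enc : (∀ k, Fin (card k)) → Fin n → Fin 2 → 𝕜
  dec : ∀ k, (Fin n → Fin 2 → 𝕜) → (Fin n → 𝕜) → Fin (card k)
  measurable_dec : ∀ k, Measurable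
    (fun p : (Fin n → Fin 2 → 𝕜) × (Fin n → 𝕜) => dec k p.1 p.2)

variable {𝕜 : Type*} [RCLike 𝕜]

/-- Average power at most `P` for every codeword. -/
def Code.PowerConstraint {n : ℕ} (C : Code 𝕜 n) (P : ℝ) : Prop :=
  ∀ m, ∑ t, ∑ a, ‖C.enc m t a‖ ^ 2 ≤ n * P

/-- The signal received over channel vectors `H` with noise `z` when `x` is sent. -/
def received {n : ℕ} (H : Fin n → Fin 2 → 𝕜) (x : Fin n → Fin 2 → 𝕜) (z : Fin n → 𝕜) :
    Fin n → 𝕜 :=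
  fun t => ∑ a, H t a * x t a + z t

/-- Probability that user `k`, with channel vectors `H`, decodes its message wrongly, for
independent uniformly distributed messages and noise that is i.i.d. over time. -/
def Code.errorProb {n : ℕ} (C : Code 𝕜 n) (k : Fin 2) (H : Fin n → Fin 2 → 𝕜) : ℝ :=
  (∑ m : (∀ j, Fin (C.card j)),
      (Measure.pi (fun _ : Fin n => awgn 𝕜)).real
        {z | C.dec k H (received H (C.enc m) z) ≠ m k}) /
    (Fintype.card (∀ j, Fin (C.card j)) : ℝ)

/-- The channel vectors of user `k` at the times `0, …, n-1`, for the block states `g j`. -/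
def channelAt (k : Fin 2) (g : ℕ → Fin 2 → 𝕜) (n : ℕ) : Fin n → Fin 2 → 𝕜 :=
  fun t => g (blockIndex k t)

/-- The pair `d` of degrees of freedom is achievable almost surely, without channel state
information at the transmitter, by codes in the class `S`.

There are rates `R k P` with `R k P = d k * log P + o(log P)` in the complex case and
`R k P = d k * (1/2) * log P + o(log P)` in the real case (in nats per symbol, as `P → ∞`), and
codes of power at most `P` and of these rates, chosen without knowledge of the realization of the
channel, such that for almost every realization and all large `P` the error probabilities tend
to `0` with the block length. -/
def AchievesDoF {Ω : Type*} [MeasurableSpace Ω] (μ : Measure Ω)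
    (h : Fin 2 → ℕ → Ω → Fin 2 → 𝕜) (S : ∀ n, Code 𝕜 n → Prop) (d : Fin 2 → ℝ) : Prop :=
  ∃ (R : Fin 2 → ℝ → ℝ) (C : ℝ → ∀ n, Code 𝕜 n),
    (∀ k, Tendsto (fun P => R k P / ((Module.finrank ℝ 𝕜 : ℝ) / 2 * Real.log P)) atTop
      (𝓝 (d k))) ∧
    (∀ P, 0 < P → ∀ n, S n (C P n) ∧ (C P n).PowerConstraint P) ∧
    (∀ P, 0 < P → ∀ k, ∀ᶠ n : ℕ in atTop, Real.exp (n * R k P) ≤ (C P n).card k) ∧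
    ∀ᵐ ω ∂μ, ∀ᶠ P in atTop, ∀ k,
      Tendsto (fun n => (C P n).errorProb k (channelAt k (fun j => h k j ω) n)) atTop (𝓝 0)

/-- A total of `D` degrees of freedom is achievable almost surely. -/
def AchievesTotalDoF {Ω : Type*} [MeasurableSpace Ω] (μ : Measure Ω)
    (h : Fin 2 → ℕ → Ω → Fin 2 → 𝕜) (D : ℝ) : Prop :=
  ∃ d : Fin 2 → ℝ, AchievesDoF μ h (fun _ _ => True) d ∧ ∑ k, d k = D

/-- The `6 × 2` beamforming matrix of user `k` in the `i`-th supersymbol, which consists of the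
times `3i, 3i+1, 3i+2`; the row `(s, a)` belongs to the time `3i+s` and the antenna `a`.
If `i` is even, user `0`'s channel changes after the first symbol of the supersymbol and user `1`'s
after the second; then the matrices are `[I; I; 0]` for user `0` and `[0; I; I]` for user `1`.
If `i` is odd, the users' roles are interchanged. -/
def beam (𝕜 : Type*) [RCLike 𝕜] (i : ℕ) (k : Fin 2) : Matrix (Fin 3 × Fin 2) (Fin 2) 𝕜 :=
  Matrix.of fun r b =>
    if r.2 = b ∧ r.1 ≠ (if Even i ↔ k = 0 then 2 else 0) then 1 else 0

/-- The codes that send, in every supersymbol, the superposition of two streams for each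
user along the columns of `beam`. The streams of a user depend on that user's message only. -/
def IsBeamformed (n : ℕ) (C : Code 𝕜 n) : Prop :=
  ∃ u : ∀ k, Fin (C.card k) → ℕ → Fin 2 → 𝕜,
    ∀ (m : ∀ k, Fin (C.card k)) (t : Fin n) (a : Fin 2),
      C.enc m t a = ∑ k, ((beam 𝕜 (t / 3) k).mulVec (u k (m k) (t / 3)))
        (⟨(t : ℕ) % 3, Nat.mod_lt _ (by norm_num)⟩, a)

end

end StaggeredBC

/-!
Over a supersymbol each user meets two successive fading blocks, one of them in two symbols. The
beamforming is arranged so that a user receives its own streams `u` alone in the symbol of the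
other block, and the other user's streams only in the two symbols of the repeated block. The
channel is the same in these two, so their difference is free of interference (`received_slot`).
User `k` is left with `v = G u + w`, where the rows of the `2 × 2` matrix `G` are the two channel
vectors. By absolute continuity `G` is almost surely invertible, which gives two degrees of
freedom per three symbols.

The achievability proof is made explicit and deterministic, so that one code serves all channels.
The streams are points of a constellation of spacing `Δ` with about `√P / Δ` levels per real
dimension, and each message is a word of a Gilbert–Varshamov code over the supersymbols
(`exists_code_hammingDist`, `exists_codebook`). The receiver picks the codeword that explains the
received signal in most supersymbols. This codeword is the right one as long as few supersymbols
are spoiled (`dec_eq_of_lt`), and there are two ways to spoil one: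

* strong noise, in a small fraction of the supersymbols because the total noise energy is at most
  linear in time, with probability tending to `1` (`exists_tendsto_noise_energy`);
* a nearly singular `G`. Fading need not be ergodic, but the maximal ergodic inequality for the
  stationary block process (`measure_exists_visits_le`) bounds the probability that the frequency
  of nearly singular pairs ever exceeds a given level, and the Borel–Cantelli lemma makes the bound
  almost sure along a sequence of levels (`exists_eventually_few_nearSingular`).

For a fixed level the spacing `Δ` is fixed, and the code loses a fixed fraction of the rate. As the
level may grow arbitrarily slowly with `P` (`exists_slow_index`), the fraction tends to `0` while
`log Δ = o(log P)`, so that the pre-log factor is not affected.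
-/

namespace StaggeredBC

noncomputable section

/-! ### Block codes with many codewords and large minimum distance -/

/-- A word at distance at most `d` from `x` is determined by a set of at most `d` positions and its
letters there. -/
lemma card_hammingBall_le {α : Type*} [Fintype α] [DecidableEq α] [Nonempty α] {N : ℕ} (d : ℕ)
    (x : Fin N → α) :
    (Finset.univ.filter fun y => hammingDist x y ≤ d).card ≤ 2 ^ N * Fintype.card α ^ d := by
  classical
  let F : Finset (Fin N) → Finset (Fin N → α) := fun T =>
    Fintype.piFinset fun i => if i ∈ T then Finset.univ else {x i}
  have hF : ∀ T, (F T).card = Fintype.card α ^ T.card := by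
    intro T
    simp only [F, Fintype.card_piFinset]
    have : ∀ i, (if i ∈ T then (Finset.univ : Finset α) else {x i}).card
        = if i ∈ T then Fintype.card α else 1 := by
      intro i; split_ifs <;> simp
    simp [this, Finset.prod_ite_mem]
  calc (Finset.univ.filter fun y => hammingDist x y ≤ d).card
      ≤ (((Finset.univ : Finset (Finset (Fin N))).filter fun T => T.card ≤ d).biUnion F).card := by
        apply Finset.card_le_card
        intro y hy
        rw [Finset.mem_filter] at hy
        rw [Finset.mem_biUnion]
        refine ⟨Finset.univ.filter fun i => x i ≠ y i, ?_, ?_⟩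
        · simpa [hammingDist] using hy.2
        · simp only [F, Fintype.mem_piFinset]
          intro i
          by_cases h : x i = y i <;> simp [h]
    _ ≤ ((Finset.univ : Finset (Finset (Fin N))).filter fun T => T.card ≤ d).card
          * Fintype.card α ^ d := by
        apply Finset.card_biUnion_le_card_mul
        intro T hT
        rw [hF]
        exact Nat.pow_le_pow_right Fintype.card_pos (Finset.mem_filter.1 hT).2
    _ ≤ 2 ^ N * Fintype.card α ^ d := by
        gcongr
        refine (Finset.card_filter_le _ _).trans ?_
        simp

/-- The Gilbert–Varshamov bound: the Hamming balls of radius `d` around the words of a maximal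
code of minimum distance more than `d` cover everything. -/
theorem exists_code_hammingDist {α : Type*} [Fintype α] [DecidableEq α] [Nonempty α] (N d : ℕ) :
    ∃ S : Finset (Fin N → α), (∀ x ∈ S, ∀ y ∈ S, x ≠ y → d < hammingDist x y) ∧
      Fintype.card α ^ N ≤ S.card * (2 ^ N * Fintype.card α ^ d) := by
  classical
  let 𝒞 : Finset (Finset (Fin N → α)) :=
    Finset.univ.filter fun S => ∀ x ∈ S, ∀ y ∈ S, x ≠ y → d < hammingDist x y
  obtain ⟨S, hS⟩ := 𝒞.exists_maximal ⟨∅, by simp [𝒞]⟩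
  have hSd : ∀ x ∈ S, ∀ y ∈ S, x ≠ y → d < hammingDist x y := (Finset.mem_filter.1 hS.1).2
  refine ⟨S, hSd, ?_⟩
  have hcover : (Finset.univ : Finset (Fin N → α)) ⊆
      S.biUnion fun x => Finset.univ.filter fun y => hammingDist x y ≤ d := by
    intro y _
    by_contra hy
    simp only [Finset.mem_biUnion, Finset.mem_filter, Finset.mem_univ, true_and, not_exists,
      not_and, not_le] at hy
    have hmem : insert y S ∈ 𝒞 := by
      refine Finset.mem_filter.2 ⟨Finset.mem_univ _, ?_⟩
      intro a ha b hb hab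
      rcases Finset.mem_insert.1 ha with rfl | ha' <;> rcases Finset.mem_insert.1 hb with rfl | hb'
      · exact absurd rfl hab
      · rw [hammingDist_comm]; exact hy b hb'
      · exact hy a ha'
      · exact hSd a ha' b hb' hab
    have hyS : y ∈ S := hS.2 hmem (Finset.subset_insert _ _) (Finset.mem_insert_self _ _)
    simpa using hy y hyS
  calc Fintype.card α ^ N = (Finset.univ : Finset (Fin N → α)).card := by simp
    _ ≤ _ := Finset.card_le_card hcover
    _ ≤ _ := Finset.card_biUnion_le_card_mul _ _ _ fun x _ => card_hammingBall_le d x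

/-! ### Signal constellations -/

/-- A pulse-amplitude constellation of unit spacing with `q` levels in each real dimension of `𝕜`. -/
theorem exists_constellation (𝕜 : Type*) [RCLike 𝕜] (q : ℕ) :
    ∃ p : (Fin (Module.finrank ℝ 𝕜) → Fin q) → 𝕜,
      (∀ a, ‖p a‖ ≤ Module.finrank ℝ 𝕜 * ((q : ℝ) - 1)) ∧
      ∀ a b, a ≠ b → 1 ≤ ‖p a - p b‖ := by
  let e := stdOrthonormalBasis ℝ 𝕜
  refine ⟨fun a => ∑ i, ((a i : ℕ) : ℝ) • e i, fun a => ?_, fun a b hab => ?_⟩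
  · refine (norm_sum_le _ _).trans ?_
    calc _ ≤ ∑ i : Fin (Module.finrank ℝ 𝕜), ((q : ℝ) - 1) := by
          refine Finset.sum_le_sum fun i _ => ?_
          rw [norm_smul, e.orthonormal.1 i, mul_one, Real.norm_natCast, le_sub_iff_add_le]
          exact_mod_cast (a i).2
      _ = _ := by simp [mul_sub]
  · obtain ⟨i, hi⟩ := Function.ne_iff.1 hab
    rw [← Finset.sum_sub_distrib]
    simp only [← sub_smul]
    have h1 : inner ℝ (e i) (∑ j, (((a j : ℕ) : ℝ) - ((b j : ℕ) : ℝ)) • e j)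
        = ((a i : ℕ) : ℝ) - ((b i : ℕ) : ℝ) := e.orthonormal.inner_right_fintype _ i
    have h2 := abs_real_inner_le_norm (e i) (∑ j, (((a j : ℕ) : ℝ) - ((b j : ℕ) : ℝ)) • e j)
    rw [h1, e.orthonormal.1 i, one_mul] at h2
    refine le_trans ?_ h2
    have hne : ((a i : ℕ) : ℤ) - ((b i : ℕ) : ℤ) ≠ 0 := by
      rw [sub_ne_zero]; exact_mod_cast fun h => hi (Fin.ext h)
    exact_mod_cast Int.one_le_abs hne

/-! ### The energy of the noise -/

instance (𝕜 : Type*) [RCLike 𝕜] : IsProbabilityMeasure (awgn 𝕜) :=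
  Measure.isProbabilityMeasure_map (by fun_prop)

lemma memLp_norm_sq_awgn (𝕜 : Type*) [RCLike 𝕜] :
    MemLp (fun z : 𝕜 => ‖z‖ ^ 2) 2 (awgn 𝕜) := by
  have h4 : MemLp (fun z : 𝕜 => z) 4 (awgn 𝕜) := by
    unfold awgn
    rw [memLp_map_measure_iff (by fun_prop) (by fun_prop)]
    have h1 : MemLp (fun x : ℝ => x) 4 (gaussianReal 0 ((Module.finrank ℝ 𝕜 : ℝ≥0)⁻¹)) :=
      memLp_id_gaussianReal' 4 (by simp)
    have hfst := (h1.comp_fst (gaussianReal 0 ((Module.finrank ℝ 𝕜 : ℝ≥0)⁻¹))).ofReal (K := 𝕜)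
    have hsnd := (h1.comp_snd (gaussianReal 0 ((Module.finrank ℝ 𝕜 : ℝ≥0)⁻¹))).ofReal (K := 𝕜)
    exact hfst.add (hsnd.mul_const _)
  rw [memLp_two_iff_integrable_sq (by fun_prop)]
  have := h4.integrable_norm_pow (p := 4) (by norm_num)
  refine this.congr (ae_of_all _ fun z => ?_)
  simp only [← pow_mul]

/-- A weak law of large numbers: the noise energy is at most linear in time. -/
theorem exists_tendsto_noise_energy (𝕜 : Type*) [RCLike 𝕜] :
    ∃ c : ℝ, 0 < c ∧ Tendsto (fun n : ℕ => (Measure.pi (fun _ : Fin n => awgn 𝕜)).real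
      {z | c * n < ∑ t, ‖z t‖ ^ 2}) atTop (𝓝 0) := by
  set E := ∫ z, ‖z‖ ^ 2 ∂(awgn 𝕜) with hE
  set V := Var[fun z : 𝕜 => ‖z‖ ^ 2; awgn 𝕜] with hV
  have hE0 : 0 ≤ E := integral_nonneg fun z => by positivity
  refine ⟨E + 1, by positivity, ?_⟩
  have hX := memLp_norm_sq_awgn 𝕜
  have hlim : Tendsto (fun n : ℕ => V / n) atTop (𝓝 0) :=
    tendsto_const_div_atTop_nhds_zero_nat V
  refine squeeze_zero' (Eventually.of_forall fun n => measureReal_nonneg) ?_ hlim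
  filter_upwards [eventually_gt_atTop 0] with n hn
  have hn' : (0 : ℝ) < n := by exact_mod_cast hn
  have hmp : ∀ t : Fin n, MeasurePreserving (fun z : Fin n → 𝕜 => z t)
      (Measure.pi fun _ => awgn 𝕜) (awgn 𝕜) := fun t => measurePreserving_eval _ t
  have hmem : ∀ t : Fin n, MemLp (fun z : Fin n → 𝕜 => ‖z t‖ ^ 2) 2
      (Measure.pi fun _ => awgn 𝕜) := fun t => hX.comp_measurePreserving (hmp t)
  have hsum : MemLp (fun z : Fin n → 𝕜 => ∑ t, ‖z t‖ ^ 2) 2 (Measure.pi fun _ => awgn 𝕜) :=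
    memLp_finsetSum _ fun t _ => hmem t
  have hmean : ∫ z : Fin n → 𝕜, ∑ t, ‖z t‖ ^ 2 ∂(Measure.pi fun _ => awgn 𝕜) = n * E := by
    rw [integral_finsetSum _ fun t _ => (hmem t).integrable (by norm_num)]
    have : ∀ t : Fin n, ∫ z : Fin n → 𝕜, ‖z t‖ ^ 2 ∂(Measure.pi fun _ => awgn 𝕜) = E := by
      intro t
      have h1 := integral_map (μ := Measure.pi fun _ : Fin n => awgn 𝕜)
        (hmp t).measurable.aemeasurable (f := fun z : 𝕜 => ‖z‖ ^ 2) (by fun_prop)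
      rw [(hmp t).map_eq] at h1
      exact h1.symm
    simp [this]
  have hvar : Var[fun z : Fin n → 𝕜 => ∑ t, ‖z t‖ ^ 2; Measure.pi fun _ => awgn 𝕜] = n * V := by
    have := variance_sum_pi (μ := fun _ : Fin n => awgn 𝕜) (X := fun _ z => ‖z‖ ^ 2)
      (fun _ => hX)
    have h2 : (fun z : Fin n → 𝕜 => ∑ t, ‖z t‖ ^ 2) = ∑ t : Fin n, fun z : Fin n → 𝕜 => ‖z t‖ ^ 2 := by
      ext z; simp
    rw [h2, this]; simp [hV]
  have hch := meas_ge_le_variance_div_sq hsum hn'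
  rw [hmean, hvar] at hch
  have h1 : (n : ℝ) * V / n ^ 2 = V / n := by field_simp
  rw [h1] at hch
  refine ENNReal.toReal_le_of_le_ofReal (div_nonneg (variance_nonneg _ _) hn'.le)
    (le_trans (measure_mono fun z hz => ?_) hch)
  simp only [Set.mem_ofPred_eq] at hz ⊢
  exact le_trans (by linarith) (le_abs_self _)

/-! ### Nearly singular pairs of channel vectors -/

/-- The determinant of the `2 × 2` matrix with rows `p.1` and `p.2`. -/
def pairDet {𝕜 : Type*} [RCLike 𝕜] (p : (Fin 2 → 𝕜) × (Fin 2 → 𝕜)) : 𝕜 :=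
  p.1 0 * p.2 1 - p.1 1 * p.2 0

/-- The pairs of channel vectors whose determinant is small relative to their size. Outside this set
zero forcing amplifies the noise by a factor of at most `1 / s`. -/
def nearSingular (𝕜 : Type*) [RCLike 𝕜] (s : ℝ) : Set ((Fin 2 → 𝕜) × (Fin 2 → 𝕜)) :=
  {p | ‖pairDet p‖ ≤ s * (‖p.1‖ + ‖p.2‖)}

variable {𝕜 : Type*} [RCLike 𝕜]

lemma measurable_pairDet : Measurable (pairDet (𝕜 := 𝕜)) := by
  unfold pairDet; fun_prop

lemma measurableSet_nearSingular (s : ℝ) : MeasurableSet (nearSingular 𝕜 s) :=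
  measurableSet_le measurable_pairDet.norm (by fun_prop)

/-- Cramer's rule, as a bound for the inverse of a pair that is not nearly singular. -/
lemma norm_le_of_notMem_nearSingular {s : ℝ} (hs : 0 < s) {A B u : Fin 2 → 𝕜} {r : ℝ}
    (hAB : (A, B) ∉ nearSingular 𝕜 s) (hA : ‖∑ a, A a * u a‖ ≤ r) (hB : ‖∑ a, B a * u a‖ ≤ r) :
    s * ‖u‖ ≤ r := by
  simp only [nearSingular, Set.mem_ofPred_eq, not_le] at hAB
  simp only [Fin.sum_univ_two] at hA hB
  have hr : 0 ≤ r := (norm_nonneg _).trans hA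
  have hpos : 0 < ‖A‖ + ‖B‖ := by
    rcases (add_nonneg (norm_nonneg A) (norm_nonneg B)).lt_or_eq with h | h
    · exact h
    · have hA0 : A = 0 := norm_eq_zero.1 (by linarith [norm_nonneg A, norm_nonneg B])
      simp [hA0, pairDet] at hAB
      exact absurd hAB (not_lt.2 (by positivity))
  have key : ∀ b, ‖pairDet (A, B)‖ * ‖u b‖ ≤ (‖A‖ + ‖B‖) * r := by
    have hc : ∀ x y X Y : 𝕜, ‖x‖ ≤ r → ‖y‖ ≤ r → ‖X‖ ≤ ‖A‖ → ‖Y‖ ≤ ‖B‖ →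
        ‖Y * x - X * y‖ ≤ (‖A‖ + ‖B‖) * r := by
      intro x y X Y hx hy hX hY
      calc ‖Y * x - X * y‖ ≤ ‖Y‖ * ‖x‖ + ‖X‖ * ‖y‖ := by
            rw [← norm_mul, ← norm_mul]; exact norm_sub_le _ _
        _ ≤ ‖B‖ * r + ‖A‖ * r := by gcongr
        _ = _ := by ring
    refine Fin.forall_fin_two.2 ⟨?_, ?_⟩
    · have := hc _ _ _ _ hA hB (norm_le_pi_norm A 1) (norm_le_pi_norm B 1)
      have h1 : pairDet (A, B) * u 0 =
          B 1 * (A 0 * u 0 + A 1 * u 1) - A 1 * (B 0 * u 0 + B 1 * u 1) := by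
        simp only [pairDet]; ring
      rw [← norm_mul, h1]
      exact this
    · have := hc _ _ _ _ hA hB (norm_le_pi_norm A 0) (norm_le_pi_norm B 0)
      have h1 : pairDet (A, B) * u 1 =
          -(B 0 * (A 0 * u 0 + A 1 * u 1) - A 0 * (B 0 * u 0 + B 1 * u 1)) := by
        simp only [pairDet]; ring
      rw [← norm_mul, h1, norm_neg]
      exact this
  have hu : ‖u‖ ≤ r / s := by
    refine (pi_norm_le_iff_of_nonneg (by positivity)).2 fun b => ?_
    rw [le_div_iff₀ hs]
    have h1 : (s * (‖A‖ + ‖B‖)) * ‖u b‖ ≤ (‖A‖ + ‖B‖) * r :=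
      (mul_le_mul_of_nonneg_right hAB.le (norm_nonneg _)).trans (key b)
    have h2 : (‖A‖ + ‖B‖) * (‖u b‖ * s) ≤ (‖A‖ + ‖B‖) * r := by linarith
    exact le_of_mul_le_mul_left h2 hpos
  rw [le_div_iff₀ hs] at hu
  linarith

/-- Singular pairs are negligible: for fixed `A ≠ 0` the vectors `B` with `pairDet (A, B) = 0` form
a proper subspace. -/
theorem addHaar_pairDet_eq_zero :
    (Measure.addHaar : Measure ((Fin 2 → 𝕜) × (Fin 2 → 𝕜))) {p | pairDet p = 0} = 0 := by
  have : FiniteDimensional ℝ (Fin 2 → 𝕜) := inferInstance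
  refine (Measure.absolutelyContinuous_isAddHaarMeasure Measure.addHaar
    ((Measure.addHaar : Measure (Fin 2 → 𝕜)).prod Measure.addHaar)) ?_
  have hm : MeasurableSet {p : (Fin 2 → 𝕜) × (Fin 2 → 𝕜) | pairDet p = 0} :=
    measurable_pairDet (measurableSet_singleton 0)
  rw [Measure.measure_prod_null hm]
  have h0 : (Measure.addHaar : Measure (Fin 2 → 𝕜)) {0} = 0 :=
    Measure.addHaar_submodule _ (⊥ : Submodule ℝ (Fin 2 → 𝕜)) bot_ne_top
  filter_upwards [compl_mem_ae_iff.2 h0] with A hA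
  let W : Submodule ℝ (Fin 2 → 𝕜) :=
    { carrier := {B | pairDet (A, B) = 0}
      add_mem' := by
        intro x y hx hy
        simp only [pairDet, Set.mem_ofPred_eq, Pi.add_apply] at *
        linear_combination hx + hy
      zero_mem' := by simp [pairDet]
      smul_mem' := by
        intro c x hx
        simp only [pairDet, Set.mem_ofPred_eq, Pi.smul_apply] at *
        rw [mul_smul_comm, mul_smul_comm, ← smul_sub, hx, smul_zero] }
  refine Measure.addHaar_submodule _ W fun hW => hA ?_
  have hall : ∀ B, pairDet (A, B) = 0 := fun B => (hW ▸ Submodule.mem_top : B ∈ W)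
  ext b
  fin_cases b
  · simpa [pairDet] using hall ![0, 1]
  · simpa [pairDet] using hall ![1, 0]

/-! ### The maximal ergodic inequality -/

/-- `partialMax T f L x` is the maximum of the Birkhoff sums of `f` at `x` of length at most `L`. -/
def partialMax {X : Type*} (T : X → X) (f : X → ℝ) : ℕ → X → ℝ
  | 0 => fun _ => 0
  | L + 1 => fun x => max 0 (f x + partialMax T f L (T x))

section Maximal

variable {X : Type*} {T : X → X} {f : X → ℝ}

lemma partialMax_nonneg (L : ℕ) (x : X) : 0 ≤ partialMax T f L x := by
  cases L with
  | zero => exact le_rfl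
  | succ L => exact le_max_left _ _

lemma partialMax_le_succ (L : ℕ) (x : X) : partialMax T f L x ≤ partialMax T f (L + 1) x := by
  induction L generalizing x with
  | zero => exact le_max_left _ _
  | succ L ih => exact max_le_max le_rfl (by linarith [ih (T x)])

lemma birkhoffSum_le_partialMax (L : ℕ) (x : X) : birkhoffSum T f L x ≤ partialMax T f L x := by
  induction L generalizing x with
  | zero => simp [partialMax]
  | succ L ih =>
    rw [birkhoffSum_succ']
    exact le_max_of_le_right (by linarith [ih (T x)])

variable [MeasurableSpace X] {ν : Measure X}

lemma measurable_partialMax (hT : Measurable T) (hf : Measurable f) (L : ℕ) :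
    Measurable (partialMax T f L) := by
  induction L with
  | zero => exact measurable_const
  | succ L ih => exact measurable_const.max (hf.add (ih.comp hT))

lemma integrable_partialMax [IsFiniteMeasure ν] (hT : MeasurePreserving T ν ν)
    (hf : Integrable f ν) (L : ℕ) : Integrable (partialMax T f L) ν := by
  induction L with
  | zero => exact integrable_zero _ _ _
  | succ L ih =>
    exact (integrable_zero X ℝ ν).sup (hf.add (hT.integrable_comp_of_integrable ih))

/-- Garsia's form of the maximal ergodic theorem. -/
lemma setIntegral_partialMax_pos_nonneg [IsFiniteMeasure ν] (hT : MeasurePreserving T ν ν)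
    (hfm : Measurable f) (hf : Integrable f ν) (L : ℕ) :
    0 ≤ ∫ x in {x | 0 < partialMax T f L x}, f x ∂ν := by
  cases L with
  | zero => simp [partialMax]
  | succ L =>
    set M := partialMax T f (L + 1) with hM
    have hMm : Measurable M := measurable_partialMax hT.measurable hfm _
    have hE : MeasurableSet {x | 0 < M x} := measurableSet_lt measurable_const hMm
    have hMi : Integrable M ν := integrable_partialMax hT hf _
    have hMTi : Integrable (M ∘ T) ν := hT.integrable_comp_of_integrable hMi
    have hint : ∫ x, (M x - (M ∘ T) x) ∂ν = 0 := by
      have h1 : ∫ x, (M ∘ T) x ∂ν = ∫ x, M x ∂ν := by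
        conv_rhs => rw [← hT.map_eq]
        rw [integral_map hT.measurable.aemeasurable hMm.aestronglyMeasurable]
        rfl
      rw [integral_sub hMi hMTi, h1, sub_self]
    rw [← integral_indicator hE]
    refine hint.ge.trans ?_
    refine integral_mono (hMi.sub hMTi) (hf.indicator hE) fun x => ?_
    have hTx : 0 ≤ M (T x) := partialMax_nonneg _ _
    -- Where `M` is positive, it is `f` plus a shorter maximum at `T x`; elsewhere it vanishes.
    by_cases hx : 0 < M x
    · have h1 : M x = f x + partialMax T f L (T x) := by
        have hx' := hx
        rw [hM] at hx' ⊢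
        simp only [partialMax] at hx' ⊢
        rcases lt_max_iff.1 hx' with h | h
        · exact absurd h (lt_irrefl _)
        · exact max_eq_right h.le
      have h2 : partialMax T f L (T x) ≤ M (T x) := partialMax_le_succ _ _
      rw [Set.indicator_of_mem (by exact hx)]
      simp only [Function.comp_apply]
      linarith
    · rw [Set.indicator_of_notMem (by exact hx)]
      simp only [Function.comp_apply]
      linarith

/-- The maximal inequality for visits to a set: the probability that the frequency of visits to `B`
ever exceeds `δ` is at most `ν B / δ`. -/
theorem measure_exists_visits_le [IsProbabilityMeasure ν] (hT : MeasurePreserving T ν ν)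
    {B : Set X} (hB : MeasurableSet B) {δ : ℝ} (hδ : 0 < δ) :
    ν {x | ∃ N : ℕ, δ * N < Set.ncard {i | i < N ∧ T^[i] x ∈ B}} ≤
      ENNReal.ofReal (ν.real B / δ) := by
  let f : X → ℝ := fun x => B.indicator 1 x - δ
  have hfm : Measurable f := (measurable_one.indicator hB).sub measurable_const
  have hf : Integrable f ν := ((integrable_const 1).indicator hB).sub (integrable_const δ)
  have hsum : ∀ N x, birkhoffSum T f N x = Set.ncard {i | i < N ∧ T^[i] x ∈ B} - δ * N := by
    intro N x
    classical
    have h1 : {i | i < N ∧ T^[i] x ∈ B} = ((Finset.range N).filter fun i => T^[i] x ∈ B : Finset ℕ) := by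
      ext i; simp
    rw [h1, Set.ncard_coe_finset, birkhoffSum, Finset.sum_sub_distrib]
    simp [Set.indicator_apply, Finset.sum_boole, mul_comm]
  have hsub : {x | ∃ N : ℕ, δ * N < Set.ncard {i | i < N ∧ T^[i] x ∈ B}} ⊆
      ⋃ L, {x | 0 < partialMax T f L x} := by
    rintro x ⟨N, hN⟩
    refine Set.mem_iUnion.2 ⟨N, lt_of_lt_of_le ?_ (birkhoffSum_le_partialMax N x)⟩
    rw [hsum]; linarith
  refine (measure_mono hsub).trans ?_
  rw [Monotone.measure_iUnion]
  · refine iSup_le fun L => ?_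
    have hE : MeasurableSet {x | 0 < partialMax T f L x} :=
      measurableSet_lt measurable_const (measurable_partialMax hT.measurable hfm _)
    have h := setIntegral_partialMax_pos_nonneg hT hfm hf L
    have h0 : Integrable (B.indicator (1 : X → ℝ)) ν :=
      (integrable_const (1 : ℝ)).indicator hB
    rw [integral_sub h0.integrableOn (integrable_const δ)] at h
    have h1 : ∫ x in {x | 0 < partialMax T f L x}, B.indicator (1 : X → ℝ) x ∂ν ≤ ν.real B := by
      rw [← integral_indicator_one hB]
      exact setIntegral_le_integral h0
        (ae_of_all _ fun x => Set.indicator_nonneg (fun _ _ => zero_le_one) x)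
    have h2 : ∫ _x in {x | 0 < partialMax T f L x}, δ ∂ν
        = ν.real {x | 0 < partialMax T f L x} * δ := by simp
    rw [h2] at h
    rw [← ofReal_measureReal]
    exact ENNReal.ofReal_le_ofReal ((le_div_iff₀ hδ).2 (by linarith))
  · refine monotone_nat_of_le_succ fun L x hx => ?_
    exact lt_of_lt_of_le hx (partialMax_le_succ L x)

end Maximal

/-! ### A slowly growing index -/

/-- Whatever the growth of `a`, an index can grow so slowly that `a` along it is `o(log P)`. -/
theorem exists_slow_index (a : ℕ → ℝ) : ∃ J : ℝ → ℕ, Tendsto J atTop atTop ∧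
    Tendsto (fun P => a (J P) / Real.log P) atTop (𝓝 0) := by
  classical
  let J : ℝ → ℕ := fun P =>
    Nat.findGreatest (fun j => |a j| ≤ Real.sqrt (Real.log P)) ⌊P⌋₊
  have hs : Tendsto (fun P => Real.sqrt (Real.log P)) atTop atTop :=
    Real.tendsto_sqrt_atTop.comp Real.tendsto_log_atTop
  refine ⟨J, ?_, ?_⟩
  · refine tendsto_atTop.2 fun j => ?_
    filter_upwards [hs.eventually_ge_atTop |a j|, eventually_ge_atTop (j : ℝ)] with P h1 h2
    exact Nat.le_findGreatest (Nat.le_floor h2) h1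
  · have hlim : Tendsto (fun P => (Real.sqrt (Real.log P))⁻¹) atTop (𝓝 0) :=
      tendsto_inv_atTop_zero.comp hs
    refine squeeze_zero_norm' ?_ hlim
    filter_upwards [hs.eventually_ge_atTop |a 0|, hs.eventually_gt_atTop 0] with P h0 hpos
    have hJ : |a (J P)| ≤ Real.sqrt (Real.log P) :=
      Nat.findGreatest_spec (P := fun j => |a j| ≤ Real.sqrt (Real.log P)) (Nat.zero_le _) h0
    have hl : 0 < Real.log P := Real.sqrt_pos.1 hpos
    rw [norm_div, Real.norm_eq_abs, Real.norm_eq_abs, abs_of_pos hl, inv_eq_one_div,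
      div_le_div_iff₀ hl hpos, one_mul]
    calc |a (J P)| * Real.sqrt (Real.log P)
        ≤ Real.sqrt (Real.log P) * Real.sqrt (Real.log P) := by gcongr
      _ = Real.log P := Real.mul_self_sqrt hl.le


/-! ### Alignment: what a receiver sees in a supersymbol -/

/-- The symbol of supersymbol `i` in which the streams of user `k` are not sent. -/
def silentSlot (i : ℕ) (k : Fin 2) : Fin 3 := if Even i ↔ k = 0 then 2 else 0

/-- The symbol of supersymbol `i` in which only the streams of user `k` are sent. -/
def aloneSlot (i : ℕ) (k : Fin 2) : Fin 3 := if Even i ↔ k = 0 then 0 else 2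

/-- The time of the `s`-th symbol of the `i`-th supersymbol. Only the supersymbols that end before
time `n` are indexed. -/
def slot {n : ℕ} (i : Fin (n / 3)) (s : Fin 3) : Fin n := ⟨3 * i + s, by omega⟩

lemma slot_injective (n : ℕ) :
    Function.Injective fun x : Fin (n / 3) × Fin 3 => (slot x.1 x.2 : Fin n) := by
  rintro ⟨i, s⟩ ⟨j, t⟩ h
  have h' : 3 * (i : ℕ) + s = 3 * j + t := congrArg Fin.val h
  ext <;> simp only <;> omega

lemma beam_mulVec (i : ℕ) (k : Fin 2) (u : Fin 2 → 𝕜) (s : Fin 3) (a : Fin 2) :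
    (beam 𝕜 i k).mulVec u (s, a) = if s ≠ silentSlot i k then u a else 0 := by
  have h : ∀ b, (beam 𝕜 i k) (s, a) b * u b
      = if a = b then (if s ≠ silentSlot i k then u b else 0) else 0 := by
    intro b
    simp only [beam, silentSlot, Matrix.of_apply]
    by_cases h1 : a = b <;> by_cases h2 : s ≠ (if Even i ↔ k = 0 then 2 else 0) <;> simp [h1, h2]
  simp only [Matrix.mulVec, dotProduct, h, Finset.sum_ite_eq, Finset.mem_univ, if_true]

lemma channelAt_silentSlot {E : Type*} {n : ℕ} (k : Fin 2) (g : ℕ → Fin 2 → E) (i : Fin (n / 3)) :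
    channelAt k g n (slot i (silentSlot i k)) = channelAt k g n (slot i 1) := by
  unfold channelAt
  congr 1
  simp only [blockIndex, silentSlot, slot]
  rcases Nat.even_or_odd (i : ℕ) with h | h
  · obtain ⟨m, hm⟩ := h
    fin_cases k <;> simp [hm] <;> omega
  · have h' := Nat.not_even_iff_odd.2 h
    obtain ⟨m, hm⟩ := h
    fin_cases k <;> simp [h'] <;> omega

/-- Zero forcing for a user does not depend on the order of its two observations. -/
lemma swap_mem_nearSingular {s : ℝ} {A B : Fin 2 → 𝕜} :
    (A, B) ∈ nearSingular 𝕜 s ↔ (B, A) ∈ nearSingular 𝕜 s := by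
  have h : pairDet (A, B) = -pairDet (B, A) := by simp only [pairDet]; ring
  simp only [nearSingular, Set.mem_ofPred_eq, h, norm_neg, add_comm]

/-- A user sees exactly two fading blocks in a supersymbol, and they are successive ones. -/
lemma channelAt_mem_nearSingular {n : ℕ} (k : Fin 2) (g : ℕ → Fin 2 → 𝕜) (i : Fin (n / 3)) (s : ℝ) :
    (channelAt k g n (slot i (aloneSlot i k)), channelAt k g n (slot i 1)) ∈ nearSingular 𝕜 s ↔
      (g (blockIndex k (3 * i)), g (blockIndex k (3 * i) + 1)) ∈ nearSingular 𝕜 s := by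
  have h : (blockIndex k (3 * i + aloneSlot i k) = blockIndex k (3 * i) ∧
        blockIndex k (3 * i + 1) = blockIndex k (3 * i) + 1) ∨
      (blockIndex k (3 * i + aloneSlot i k) = blockIndex k (3 * i) + 1 ∧
        blockIndex k (3 * i + 1) = blockIndex k (3 * i)) := by
    simp only [blockIndex, aloneSlot]
    rcases Nat.even_or_odd (i : ℕ) with h | h
    · obtain ⟨m, hm⟩ := h
      fin_cases k <;> simp [hm] <;> omega
    · have h' := Nat.not_even_iff_odd.2 h
      obtain ⟨m, hm⟩ := h
      fin_cases k <;> simp [h'] <;> omega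
  simp only [channelAt, slot, Fin.val_one]
  rcases h with ⟨h1, h2⟩ | ⟨h1, h2⟩
  · rw [h1, h2]
  · rw [h1, h2, swap_mem_nearSingular]

/-! ### The beamformed code and its decoder -/

/-- The streams `u` of user `k` explain what this user receives in supersymbol `i`, up to noise of
energy `θ` in each of two observations. The first is the symbol in which user `k`'s streams are
alone, the second the difference of the two symbols that contain the other user's streams: the
channel of user `k` is the same in both, so that the interference cancels. -/
def Fits {n : ℕ} (θ : ℝ) (k : Fin 2) (H : Fin n → Fin 2 → 𝕜) (y : Fin n → 𝕜) (i : Fin (n / 3))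
    (u : Fin 2 → 𝕜) : Prop :=
  ‖y (slot i (aloneSlot i k)) - ∑ a, H (slot i (aloneSlot i k)) a * u a‖ ^ 2 ≤ θ ∧
  ‖y (slot i 1) - y (slot i (silentSlot i k)) - ∑ a, H (slot i 1) a * u a‖ ^ 2 ≤ θ

open scoped Classical in
/-- The number of supersymbols in which the streams `u` do not explain the received signal. -/
def misfits {n : ℕ} (θ : ℝ) (k : Fin 2) (H : Fin n → Fin 2 → 𝕜) (y : Fin n → 𝕜)
    (u : ℕ → Fin 2 → 𝕜) : ℕ :=
  (Finset.univ.filter fun i : Fin (n / 3) => ¬ Fits θ k H y i (u i)).card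

lemma measurable_misfits {n : ℕ} (θ : ℝ) (k : Fin 2) (u : ℕ → Fin 2 → 𝕜) :
    Measurable fun p : (Fin n → Fin 2 → 𝕜) × (Fin n → 𝕜) => misfits θ k p.1 p.2 u := by
  classical
  simp only [misfits, Finset.card_filter]
  refine Finset.measurable_sum _ fun i _ => Measurable.ite ?_ measurable_const measurable_const
  refine MeasurableSet.compl (MeasurableSet.inter ?_ ?_)
  · refine measurableSet_le (f := fun p : (Fin n → Fin 2 → 𝕜) × (Fin n → 𝕜) =>
      ‖p.2 (slot i (aloneSlot i k)) - ∑ a, p.1 (slot i (aloneSlot i k)) a * u i a‖ ^ 2) ?_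
      measurable_const
    fun_prop
  · refine measurableSet_le (f := fun p : (Fin n → Fin 2 → 𝕜) × (Fin n → 𝕜) =>
      ‖p.2 (slot i 1) - p.2 (slot i (silentSlot i k)) - ∑ a, p.1 (slot i 1) a * u i a‖ ^ 2) ?_
      measurable_const
    fun_prop

/-- An index at which a tuple of natural numbers is minimal. -/
def argmin {M : ℕ} (hM : 0 < M) (w : Fin M → ℕ) : Fin M :=
  haveI : Nonempty (Fin M) := ⟨⟨0, hM⟩⟩
  (Finite.exists_min w).choose

lemma argmin_le {M : ℕ} (hM : 0 < M) (w : Fin M → ℕ) (m : Fin M) : w (argmin hM w) ≤ w m :=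
  haveI : Nonempty (Fin M) := ⟨⟨0, hM⟩⟩
  (Finite.exists_min w).choose_spec m

/-- The beamformed code in which both users use the codebook `c` of stream sequences, and each
decodes to the codeword with the fewest misfits. -/
def beamformedCode (n : ℕ) {M : ℕ} (hM : 0 < M) (c : Fin M → ℕ → Fin 2 → 𝕜) (θ : ℝ) : Code 𝕜 n where
  card _ := M
  card_pos _ := hM
  enc m t a := ∑ k, ((beam 𝕜 (t / 3) k).mulVec (c (m k) (t / 3)))
    (⟨(t : ℕ) % 3, Nat.mod_lt _ (by norm_num)⟩, a)
  dec k H y := argmin hM fun m => misfits θ k H y (c m)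
  measurable_dec k := (Measurable.of_discrete (f := argmin hM)).comp
    (measurable_pi_lambda _ fun m => measurable_misfits θ k (c m))

section Code

variable {n M : ℕ} {hM : 0 < M} {c : Fin M → ℕ → Fin 2 → 𝕜} {θ : ℝ}

lemma isBeamformed_beamformedCode : IsBeamformed n (beamformedCode n hM c θ) :=
  ⟨fun _ => c, fun _ _ _ => rfl⟩

lemma powerConstraint_beamformedCode {b P : ℝ} (hc : ∀ m i a, ‖c m i a‖ ≤ b)
    (hb : 8 * b ^ 2 ≤ P) : (beamformedCode n hM c θ).PowerConstraint P := by
  intro m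
  have hb0 : 0 ≤ b := (norm_nonneg _).trans (hc ⟨0, hM⟩ 0 0)
  have h1 : ∀ (t : Fin n) (a : Fin 2), ‖(beamformedCode n hM c θ).enc m t a‖ ^ 2 ≤ (2 * b) ^ 2 := by
    intro t a
    refine pow_le_pow_left₀ (norm_nonneg _) ?_ 2
    simp only [beamformedCode]
    refine (norm_sum_le_of_le (f := _) (n := fun _ => b) _ fun k _ => ?_).trans (by simp)
    rw [beam_mulVec]
    split_ifs
    · exact hc _ _ _
    · simpa using hb0
  calc ∑ t, ∑ a, ‖(beamformedCode n hM c θ).enc m t a‖ ^ 2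
      ≤ ∑ _t : Fin n, ∑ _a : Fin 2, (2 * b) ^ 2 :=
        Finset.sum_le_sum fun t _ => Finset.sum_le_sum fun a _ => h1 t a
    _ = n * (8 * b ^ 2) := by
        simp only [Finset.sum_const, Finset.card_univ, Fintype.card_fin, nsmul_eq_mul]
        push_cast
        ring
    _ ≤ n * P := by gcongr

lemma enc_slot (m : Fin 2 → Fin M) (i : Fin (n / 3)) (s : Fin 3) (a : Fin 2) :
    (beamformedCode n hM c θ).enc m (slot i s) a =
      ∑ k, if s ≠ silentSlot i k then c (m k) i a else 0 := by
  have h1 : (3 * (i : ℕ) + s) / 3 = i := by omega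
  have h2 : (3 * (i : ℕ) + s) % 3 = s := by omega
  simp only [beamformedCode, slot, h1, h2, Fin.eta, beam_mulVec]

/-- The two observations of a user are free of interference: the alone slot of a user is the silent
slot of the other, and in the remaining two symbols the other user's streams arrive over equal
channel vectors. -/
lemma received_slot {k : Fin 2} {H : Fin n → Fin 2 → 𝕜}
    (hH : ∀ i, H (slot i (silentSlot i k)) = H (slot i 1)) (m : Fin 2 → Fin M) (z : Fin n → 𝕜)
    (i : Fin (n / 3)) :
    received H ((beamformedCode n hM c θ).enc m) z (slot i (aloneSlot i k)) =
        ∑ a, H (slot i (aloneSlot i k)) a * c (m k) i a + z (slot i (aloneSlot i k)) ∧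
    received H ((beamformedCode n hM c θ).enc m) z (slot i 1) -
        received H ((beamformedCode n hM c θ).enc m) z (slot i (silentSlot i k)) =
      ∑ a, H (slot i 1) a * c (m k) i a + (z (slot i 1) - z (slot i (silentSlot i k))) := by
  simp only [received, enc_slot, hH i, Fin.sum_univ_two]
  by_cases h : Even (i : ℕ) <;> fin_cases k <;>
    simp [silentSlot, aloneSlot, h] <;> ring

/-- The transmitted codeword misfits only where the noise is strong. -/
lemma misfits_transmitted_le {k : Fin 2} {H : Fin n → Fin 2 → 𝕜} (hθ : 0 ≤ θ)
    (hH : ∀ i, H (slot i (silentSlot i k)) = H (slot i 1)) (m : Fin 2 → Fin M) (z : Fin n → 𝕜) :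
    misfits θ k H (received H ((beamformedCode n hM c θ).enc m) z) (c (m k)) * θ ≤
      2 * ∑ t, ‖z t‖ ^ 2 := by
  classical
  calc _ ≤ ∑ i : Fin (n / 3), ∑ s : Fin 3, 2 * ‖z (slot i s)‖ ^ 2 := by
        rw [misfits, Finset.card_filter, Nat.cast_sum, Finset.sum_mul]
        refine Finset.sum_le_sum fun i _ => ?_
        by_cases h : Fits θ k H (received H ((beamformedCode n hM c θ).enc m) z) i (c (m k) i)
        · simp only [h, not_true_eq_false, if_false, Nat.cast_zero, zero_mul]
          positivity
        · have h0 : ∀ s, ‖z (slot i s)‖ ^ 2 ≤ ∑ s : Fin 3, ‖z (slot i s)‖ ^ 2 := fun s =>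
            Finset.single_le_sum (f := fun s => ‖z (slot i s)‖ ^ 2)
              (fun _ _ => by positivity) (Finset.mem_univ s)
          have h2 : ‖z (slot i 1)‖ ^ 2 + ‖z (slot i (silentSlot i k))‖ ^ 2 ≤
              ∑ s : Fin 3, ‖z (slot i s)‖ ^ 2 := by
            rw [Fin.sum_univ_three]
            unfold silentSlot
            split_ifs <;> nlinarith [sq_nonneg ‖z (slot i 0)‖, sq_nonneg ‖z (slot i 2)‖]
          simp only [h, not_false_eq_true, if_true, Nat.cast_one, one_mul, ← Finset.mul_sum]
          obtain ⟨e1, e2⟩ := received_slot (hM := hM) (c := c) (θ := θ) hH m z i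
          simp only [Fits, e1, e2, add_sub_cancel_left, not_and_or, not_le] at h
          rcases h with h | h
          · have := h0 (aloneSlot i k)
            nlinarith [sq_nonneg ‖z (slot i (aloneSlot i k))‖]
          · have h3 : ‖z (slot i 1) - z (slot i (silentSlot i k))‖ ^ 2 ≤
                (‖z (slot i 1)‖ + ‖z (slot i (silentSlot i k))‖) ^ 2 :=
              pow_le_pow_left₀ (norm_nonneg _) (norm_sub_le _ _) 2
            nlinarith [sq_nonneg (‖z (slot i 1)‖ - ‖z (slot i (silentSlot i k))‖)]
    _ = 2 * ∑ x : Fin (n / 3) × Fin 3, ‖z (slot x.1 x.2)‖ ^ 2 := by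
        rw [Fintype.sum_prod_type, Finset.mul_sum]
        simp only [Finset.mul_sum]
    _ ≤ 2 * ∑ t, ‖z t‖ ^ 2 := by
        gcongr
        have h1 := Finset.sum_image (s := Finset.univ) (f := fun t => ‖z t‖ ^ 2)
          ((slot_injective n).injOn)
        rw [← h1]
        exact Finset.sum_le_univ_sum_of_nonneg fun t => by positivity

open scoped Classical in
/-- If the codewords differ in many supersymbols, few channel pairs are nearly singular and the
noise is strong in few supersymbols, then decoding is correct. -/
lemma dec_eq_of_lt {k : Fin 2} {H : Fin n → Fin 2 → 𝕜} {s Δ : ℝ} (hs : 0 < s)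
    (hΔ : 2 * √θ < s * Δ) (m : Fin M) (y : Fin n → 𝕜)
    (hlt : ∀ m', m' ≠ m →
      (Finset.univ.filter fun i : Fin (n / 3) =>
          (H (slot i (aloneSlot i k)), H (slot i 1)) ∈ nearSingular 𝕜 s).card +
        2 * misfits θ k H y (c m) <
      (Finset.univ.filter fun i : Fin (n / 3) => Δ ≤ ‖c m' i - c m i‖).card) :
    (beamformedCode n hM c θ).dec k H y = m := by
  by_contra hne
  have hmin := argmin_le hM (fun m => misfits θ k H y (c m)) m
  set m' := argmin hM fun m => misfits θ k H y (c m) with hm'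
  have hlt' := hlt m' hne
  have hsub : (Finset.univ.filter fun i : Fin (n / 3) => Δ ≤ ‖c m' i - c m i‖) ⊆
      (Finset.univ.filter fun i : Fin (n / 3) =>
          (H (slot i (aloneSlot i k)), H (slot i 1)) ∈ nearSingular 𝕜 s) ∪
        ((Finset.univ.filter fun i : Fin (n / 3) => ¬ Fits θ k H y i (c m i)) ∪
         (Finset.univ.filter fun i : Fin (n / 3) => ¬ Fits θ k H y i (c m' i))) := by
    intro i hi
    simp only [Finset.mem_union, Finset.mem_filter, Finset.mem_univ, true_and] at hi ⊢
    by_contra hcon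
    simp only [not_or, not_not] at hcon
    obtain ⟨hG, ⟨hm1, hm2⟩, hm1', hm2'⟩ := hcon
    have hclose : ∀ (v : 𝕜) (h : Fin 2 → 𝕜), ‖v - ∑ a, h a * c m i a‖ ^ 2 ≤ θ →
        ‖v - ∑ a, h a * c m' i a‖ ^ 2 ≤ θ → ‖∑ a, h a * (c m' i - c m i) a‖ ≤ 2 * √θ := by
      intro v h h1 h2
      have e : ∑ a, h a * (c m' i - c m i) a =
          (v - ∑ a, h a * c m i a) - (v - ∑ a, h a * c m' i a) := by
        simp only [Pi.sub_apply, mul_sub, Finset.sum_sub_distrib]; ring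
      rw [e, two_mul]
      exact (norm_sub_le _ _).trans
        (add_le_add (Real.le_sqrt_of_sq_le h1) (Real.le_sqrt_of_sq_le h2))
    have := norm_le_of_notMem_nearSingular hs hG (hclose _ _ hm1 hm1') (hclose _ _ hm2 hm2')
    nlinarith
  have h1 := (Finset.card_le_card hsub).trans (Finset.card_union_le _ _)
  have h2 := Finset.card_union_le
    (Finset.univ.filter fun i : Fin (n / 3) => ¬ Fits θ k H y i (c m i))
    (Finset.univ.filter fun i : Fin (n / 3) => ¬ Fits θ k H y i (c m' i))
  simp only [misfits] at hlt' hmin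
  omega

/-- The error probability is at most the probability that the noise energy is large. -/
theorem errorProb_beamformedCode_le {k : Fin 2} {g : ℕ → Fin 2 → 𝕜} {s Δ δ C : ℝ} (hn : 3 ≤ n)
    (hs : 0 < s) (hδ : 0 < δ) (hC : 0 < C) (hθ : θ = 10 * C / δ) (hΔ : 2 * √θ < s * Δ)
    (hc : ∀ m m', m ≠ m' → 4 * δ * (n / 3 : ℕ) <
      Set.ncard {i : Fin (n / 3) | Δ ≤ ‖c m i - c m' i‖})
    (hg : ∀ N : ℕ, Set.ncard {i | i < N ∧ (g i, g (i + 1)) ∈ nearSingular 𝕜 s} ≤ δ * N) :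
    (beamformedCode n hM c θ).errorProb k (channelAt k g n) ≤
      (Measure.pi (fun _ : Fin n => awgn 𝕜)).real {z | C * n < ∑ t, ‖z t‖ ^ 2} := by
  classical
  have hθ0 : 0 < θ := by rw [hθ]; positivity
  set H := channelAt k g n
  have hH : ∀ i, H (slot i (silentSlot i k)) = H (slot i 1) := channelAt_silentSlot k g
  have hbad : ((Finset.univ.filter fun i : Fin (n / 3) =>
      (H (slot i (aloneSlot i k)), H (slot i 1)) ∈ nearSingular 𝕜 s).card : ℝ) ≤
        2 * δ * (n / 3 : ℕ) := by
    have h1 := hg (2 * (n / 3))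
    have h2 : (Finset.univ.filter fun i : Fin (n / 3) =>
        (H (slot i (aloneSlot i k)), H (slot i 1)) ∈ nearSingular 𝕜 s).card ≤
          Set.ncard {i | i < 2 * (n / 3) ∧ (g i, g (i + 1)) ∈ nearSingular 𝕜 s} := by
      rw [← Set.ncard_coe_finset]
      -- Different supersymbols start in different fading blocks, all of index below `2 * (n / 3)`.
      refine Set.ncard_le_ncard_of_injOn (fun i => blockIndex k (3 * i)) ?_ ?_
        ((Set.finite_lt_nat (2 * (n / 3))).subset fun i hi => hi.1)
      · intro i hi
        simp only [Finset.coe_filter, Finset.mem_univ, true_and, Set.mem_ofPred_eq] at hi ⊢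
        refine ⟨?_, (channelAt_mem_nearSingular k g i s).1 hi⟩
        have := i.2
        unfold blockIndex
        split_ifs <;> omega
      · intro i _ j _ hij
        simp only [blockIndex] at hij
        ext
        split_ifs at hij <;> omega
    have h3 : ((2 * (n / 3) : ℕ) : ℝ) = 2 * (n / 3 : ℕ) := by push_cast; rfl
    calc _ ≤ ((Set.ncard {i | i < 2 * (n / 3) ∧ (g i, g (i + 1)) ∈ nearSingular 𝕜 s} : ℕ) : ℝ) := by
          exact_mod_cast h2
      _ ≤ _ := h1.trans (by rw [h3]; linarith)
  have hnN : (n : ℝ) ≤ 5 * (n / 3 : ℕ) := by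
    have : n ≤ 5 * (n / 3) := by omega
    exact_mod_cast this
  have hdec : ∀ (m : Fin 2 → Fin M) (z : Fin n → 𝕜), ¬ C * n < ∑ t, ‖z t‖ ^ 2 →
      (beamformedCode n hM c θ).dec k H
        (received H ((beamformedCode n hM c θ).enc m) z) = m k := by
    intro m z hz
    rw [not_lt] at hz
    refine dec_eq_of_lt hs hΔ (m k) _ fun m' hm' => ?_
    have h1 := misfits_transmitted_le (hM := hM) (c := c) hθ0.le hH m z
    set w := misfits θ k H (received H ((beamformedCode n hM c θ).enc m) z) (c (m k))
    have h2 : (w : ℝ) ≤ δ * (n / 3 : ℕ) := by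
      have h3 : (w : ℝ) * θ ≤ (δ * (n / 3 : ℕ)) * θ := by
        have : (δ * (n / 3 : ℕ)) * θ = 10 * C * (n / 3 : ℕ) := by rw [hθ]; field_simp
        rw [this]
        nlinarith
      exact le_of_mul_le_mul_right h3 hθ0
    have h4 := hc m' (m k) hm'
    have h5 : {i : Fin (n / 3) | Δ ≤ ‖c m' i - c (m k) i‖} =
        (Finset.univ.filter fun i : Fin (n / 3) => Δ ≤ ‖c m' i - c (m k) i‖ : Finset _) := by
      ext i; simp
    rw [h5, Set.ncard_coe_finset] at h4
    have : (((Finset.univ.filter fun i : Fin (n / 3) =>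
        (H (slot i (aloneSlot i k)), H (slot i 1)) ∈ nearSingular 𝕜 s).card + 2 * w : ℕ) : ℝ) <
        (Finset.univ.filter fun i : Fin (n / 3) => Δ ≤ ‖c m' i - c (m k) i‖).card := by
      push_cast
      linarith
    exact_mod_cast this
  unfold Code.errorProb
  have hpos : 0 < Fintype.card (∀ j, Fin ((beamformedCode n hM c θ).card j)) :=
    Fintype.card_pos_iff.2 ⟨fun _ => ⟨0, hM⟩⟩
  rw [div_le_iff₀ (by exact_mod_cast hpos)]
  refine (Finset.sum_le_card_nsmul Finset.univ _
    ((Measure.pi (fun _ : Fin n => awgn 𝕜)).real {z | C * n < ∑ t, ‖z t‖ ^ 2})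
    fun m _ => measureReal_mono fun z hz => ?_).trans ?_
  · by_contra hcon
    exact hz (hdec m z hcon)
  · rw [nsmul_eq_mul, Finset.card_univ, mul_comm]

end Code

/-- Codebooks of stream sequences over `N` supersymbols, with points spaced by `Δ`: Gilbert–Varshamov codes over the pairs of
points of a constellation with `q + 1` levels per real dimension. -/
theorem exists_codebook (𝕜 : Type*) [RCLike 𝕜] (q N : ℕ) {κ Δ : ℝ} (hκ : 0 ≤ κ) (hΔ : 0 ≤ Δ) :
    ∃ (M : ℕ) (c : Fin M → ℕ → Fin 2 → 𝕜), 0 < M ∧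
      (∀ m i a, ‖c m i a‖ ≤ Δ * (Module.finrank ℝ 𝕜 * q)) ∧
      (∀ m m', m ≠ m' → κ * N < Set.ncard {i : Fin N | Δ ≤ ‖c m i - c m' i‖}) ∧
      N * (2 * Module.finrank ℝ 𝕜 * Real.log (q + 1 : ℕ) * (1 - κ) - Real.log 2) ≤ Real.log M := by
  classical
  obtain ⟨p, hp, hpd⟩ := exists_constellation 𝕜 (q + 1)
  let α := Fin 2 → Fin (Module.finrank ℝ 𝕜) → Fin (q + 1)
  obtain ⟨S, hS, hcard⟩ := exists_code_hammingDist (α := α) N ⌊κ * N⌋₊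
  have hα : Fintype.card α = (q + 1) ^ (2 * Module.finrank ℝ 𝕜) := by
    simp [α, ← pow_mul, mul_comm]
  have hα0 : 0 < Fintype.card α := Fintype.card_pos
  have hS0 : 0 < S.card := by
    rcases Nat.eq_zero_or_pos S.card with h | h
    · rw [h, zero_mul] at hcard
      exact absurd hcard (not_le.2 (pow_pos hα0 N))
    · exact h
  let w : Fin S.card → Fin N → α := fun m => (S.equivFin.symm m : Fin N → α)
  refine ⟨S.card, fun m i a => if h : i < N then (Δ : 𝕜) * p (w m ⟨i, h⟩ a) else 0, hS0, ?_, ?_, ?_⟩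
  · intro m i a
    have h0 : 0 ≤ Δ * (Module.finrank ℝ 𝕜 * q : ℝ) := by positivity
    dsimp only
    split_ifs with h
    · rw [norm_mul, RCLike.norm_ofReal, abs_of_nonneg hΔ]
      have := hp (w m ⟨i, h⟩ a)
      push_cast at this
      rw [add_sub_cancel_right] at this
      gcongr
    · simpa using h0
  · intro m m' hm
    have hne : w m ≠ w m' := fun h => hm (S.equivFin.symm.injective (Subtype.ext h))
    have hd := hS _ (S.equivFin.symm m).2 _ (S.equivFin.symm m').2 hne
    refine (Nat.lt_of_floor_lt hd).trans_le ?_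
    rw [Nat.cast_le, hammingDist, ← Set.ncard_coe_finset]
    refine Set.ncard_le_ncard ?_ (Set.toFinite _)
    intro i hi
    have hi' : w m i ≠ w m' i := by simpa using hi
    obtain ⟨a, ha⟩ := Function.ne_iff.1 hi'
    refine le_trans ?_ (norm_le_pi_norm _ a)
    simp only [Pi.sub_apply, Fin.is_lt, dif_pos, Fin.eta, ← mul_sub]
    rw [norm_mul, RCLike.norm_ofReal, abs_of_nonneg hΔ]
    exact le_mul_of_one_le_right hΔ (hpd _ _ ha)
  · have hlogα : Real.log (Fintype.card α) = 2 * Module.finrank ℝ 𝕜 * Real.log (q + 1 : ℕ) := by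
      rw [hα, Nat.cast_pow, Real.log_pow]; push_cast; ring
    have hlogα0 : 0 ≤ Real.log (Fintype.card α) := Real.log_natCast_nonneg _
    have h1 : Real.log ((Fintype.card α : ℝ) ^ N) ≤
        Real.log (S.card * (2 ^ N * (Fintype.card α : ℝ) ^ ⌊κ * N⌋₊)) :=
      Real.log_le_log (by positivity) (by exact_mod_cast hcard)
    rw [Real.log_mul (by positivity) (by positivity), Real.log_mul (by positivity) (by positivity),
      Real.log_pow, Real.log_pow, Real.log_pow] at h1
    have h2 : (⌊κ * N⌋₊ : ℝ) * Real.log (Fintype.card α) ≤ κ * N * Real.log (Fintype.card α) :=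
      mul_le_mul_of_nonneg_right (Nat.floor_le (by positivity)) hlogα0
    rw [← hlogα]
    linarith

/-! ### The frequency of nearly singular channels -/

/-- For a generic fading process, nearly singular pairs have small probability, so by the maximal
inequality and the Borel–Cantelli lemma their frequency is small at all times at once. -/
theorem exists_eventually_few_nearSingular {Ω : Type*} [MeasurableSpace Ω] (μ : Measure Ω)
    [IsProbabilityMeasure μ] (h : Fin 2 → ℕ → Ω → Fin 2 → 𝕜) (hh : IsGenericBlockFading μ h)
    (δ : ℕ → ℝ) (hδ : ∀ j, 0 < δ j) :
    ∃ s : ℕ → ℝ, (∀ j, 0 < s j) ∧ ∀ᵐ ω ∂μ, ∀ᶠ j in atTop, ∀ k, ∀ N : ℕ,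
      Set.ncard {i | i < N ∧ (h k i ω, h k (i + 1) ω) ∈ nearSingular 𝕜 (s j)} ≤ δ j * N := by
  have hpair : ∀ k, Measurable fun ω => (h k 0 ω, h k 1 ω) := fun k =>
    (hh.measurable k 0).prodMk (hh.measurable k 1)
  let ρ : Fin 2 → Measure ((Fin 2 → 𝕜) × (Fin 2 → 𝕜)) := fun k => μ.map fun ω => (h k 0 ω, h k 1 ω)
  have hρ : ∀ k, IsProbabilityMeasure (ρ k) := fun k =>
    Measure.isProbabilityMeasure_map (hpair k).aemeasurable
  have hanti : Antitone fun l : ℕ => nearSingular 𝕜 (1 / ((l : ℝ) + 1)) := by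
    intro l l' hl p hp
    simp only [nearSingular, Set.mem_ofPred_eq] at hp ⊢
    exact hp.trans (mul_le_mul_of_nonneg_right (Nat.one_div_le_one_div hl) (by positivity))
  have hinter : ⋂ l : ℕ, nearSingular 𝕜 (1 / ((l : ℝ) + 1)) ⊆ {p | pairDet p = 0} := by
    intro p hp
    have h1 : Tendsto (fun l : ℕ => 1 / ((l : ℝ) + 1) * (‖p.1‖ + ‖p.2‖)) atTop
        (𝓝 (0 * (‖p.1‖ + ‖p.2‖))) := tendsto_one_div_add_atTop_nhds_zero_nat.mul_const _
    rw [zero_mul] at h1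
    have h2 := ge_of_tendsto' h1 fun l => (Set.mem_iInter.1 hp l)
    simpa using h2
  have hzero : ∀ k, Tendsto (fun l : ℕ => ρ k (nearSingular 𝕜 (1 / ((l : ℝ) + 1)))) atTop
      (𝓝 0) := by
    intro k
    have h1 := tendsto_measure_iInter_atTop (μ := ρ k)
      (fun l : ℕ => (measurableSet_nearSingular (𝕜 := 𝕜) (1 / ((l : ℝ) + 1))).nullMeasurableSet)
      hanti ⟨0, measure_ne_top _ _⟩
    have h2 : ρ k (⋂ l : ℕ, nearSingular 𝕜 (1 / ((l : ℝ) + 1))) = 0 :=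
      measure_mono_null hinter (hh.generic k 0 addHaar_pairDet_eq_zero)
    rwa [h2] at h1
  have hex : ∀ j : ℕ, ∃ l : ℕ, ∀ k, ρ k (nearSingular 𝕜 (1 / ((l : ℝ) + 1))) ≤
      ENNReal.ofReal (δ j * (1 / 2) ^ j) := by
    intro j
    have hpos : 0 < ENNReal.ofReal (δ j * (1 / 2) ^ j) :=
      ENNReal.ofReal_pos.2 (mul_pos (hδ j) (by positivity))
    exact (eventually_all.2 fun k => (hzero k).eventually_le_const hpos).exists
  choose l hl using hex
  refine ⟨fun j => 1 / ((l j : ℝ) + 1), fun j => Nat.one_div_pos_of_nat, ?_⟩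
  have hk : ∀ k, ∀ᵐ ω ∂μ, ∀ᶠ j in atTop, ∀ N : ℕ,
      Set.ncard {i | i < N ∧ (h k i ω, h k (i + 1) ω) ∈ nearSingular 𝕜 (1 / ((l j : ℝ) + 1))} ≤
        δ j * N := by
    intro k
    let seq : Ω → ℕ → Fin 2 → 𝕜 := fun ω i => h k i ω
    have hseq : Measurable seq := measurable_pi_lambda _ (hh.measurable k)
    let T : (ℕ → Fin 2 → 𝕜) → (ℕ → Fin 2 → 𝕜) := fun x i => x (i + 1)
    have hTm : Measurable T := measurable_pi_lambda _ fun i => measurable_pi_apply _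
    have hT : MeasurePreserving T (μ.map seq) (μ.map seq) := by
      refine ⟨hTm, ?_⟩
      rw [Measure.map_map hTm hseq]
      exact hh.stationary k
    have hprob : IsProbabilityMeasure (μ.map seq) :=
      Measure.isProbabilityMeasure_map hseq.aemeasurable
    have hiter : ∀ (i : ℕ) (x : ℕ → Fin 2 → 𝕜) (t : ℕ), T^[i] x t = x (t + i) := by
      intro i
      induction i with
      | zero => intro x t; rfl
      | succ i ih =>
        intro x t
        rw [Function.iterate_succ_apply, ih]
        exact congrArg x (by ring)
    let B : ℕ → Set (ℕ → Fin 2 → 𝕜) := fun j =>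
      {x | (x 0, x 1) ∈ nearSingular 𝕜 (1 / ((l j : ℝ) + 1))}
    have hB : ∀ j, MeasurableSet (B j) := fun j =>
      ((measurable_pi_apply 0).prodMk (measurable_pi_apply 1)) (measurableSet_nearSingular _)
    have hBμ : ∀ j, (μ.map seq).real (B j) / δ j ≤ (1 / 2) ^ j := by
      intro j
      rw [div_le_iff₀ (hδ j), mul_comm]
      refine ENNReal.toReal_le_of_le_ofReal (mul_nonneg (hδ j).le (by positivity)) ?_
      have h1 := hl j k
      rw [Measure.map_apply (hpair k) (measurableSet_nearSingular _)] at h1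
      rw [Measure.map_apply hseq (hB j)]
      exact h1
    let E : ℕ → Set Ω := fun j => {ω | ∃ N : ℕ, δ j * N < Set.ncard
      {i | i < N ∧ (h k i ω, h k (i + 1) ω) ∈ nearSingular 𝕜 (1 / ((l j : ℝ) + 1))}}
    have hE : ∀ j, μ (E j) ≤ ENNReal.ofReal ((1 / 2) ^ j) := by
      intro j
      have h1 := measure_exists_visits_le hT (hB j) (hδ j)
      refine le_trans ?_ (h1.trans (ENNReal.ofReal_le_ofReal (hBμ j)))
      refine le_trans (measure_mono fun ω hω => ?_) (Measure.le_map_apply hseq.aemeasurable _)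
      obtain ⟨N, hN⟩ := hω
      refine ⟨N, ?_⟩
      simpa only [B, Set.mem_ofPred_eq, hiter, zero_add, add_comm 1, seq] using hN
    have hsum : ∑' j, μ (E j) ≠ ∞ := by
      refine ne_top_of_le_ne_top ?_ (ENNReal.tsum_le_tsum hE)
      rw [← ENNReal.ofReal_tsum_of_nonneg (fun j => by positivity) summable_geometric_two]
      exact ENNReal.ofReal_ne_top
    filter_upwards [ae_eventually_notMem hsum] with ω hω
    filter_upwards [hω] with j hj N
    by_contra hcon
    exact hj ⟨N, not_le.1 hcon⟩
  filter_upwards [ae_all_iff.2 hk] with ω hω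
  exact eventually_all.2 hω

/-! ### Rates -/

/-- Passing from `N = n / 3` supersymbols to `n` symbols costs a vanishing part of the rate; the
term `1` makes room for it. -/
lemma eventually_exp_rate_le {L : ℝ} {M : ℕ → ℕ} (hM : ∀ n, 0 < M n)
    (h : ∀ n, (n / 3 : ℕ) * L ≤ Real.log (M n)) :
    ∀ᶠ n : ℕ in atTop, Real.exp (n * (L / 3 - 1)) ≤ M n := by
  filter_upwards [tendsto_natCast_atTop_atTop.eventually_ge_atTop |L|] with n hn
  rw [← Real.le_log_iff_exp_le (by exact_mod_cast hM n)]
  refine le_trans ?_ (h n)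
  have h1 : ((n / 3 : ℕ) : ℝ) ≤ n / 3 := Nat.cast_div_le
  have h2 : (n : ℝ) / 3 ≤ (n / 3 : ℕ) + 1 := by
    have : n ≤ 3 * (n / 3 + 1) := by omega
    have h3 : (n : ℝ) ≤ 3 * ((n / 3 : ℕ) + 1) := by exact_mod_cast this
    linarith
  have h3 : (n / 3 - (n / 3 : ℕ) : ℝ) * L ≤ |L| := by
    calc _ ≤ |(n / 3 - (n / 3 : ℕ) : ℝ) * L| := le_abs_self _
      _ = |(n / 3 - (n / 3 : ℕ) : ℝ)| * |L| := abs_mul _ _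
      _ ≤ 1 * |L| := by
        gcongr
        rw [abs_le]; constructor <;> linarith
      _ = |L| := one_mul _
  linarith

lemma tendsto_rate {r : ℝ} (hr : 0 < r) {b κ : ℝ → ℝ}
    (hb : Tendsto (fun P => b P / Real.log P) atTop (𝓝 0)) (hκ : Tendsto κ atTop (𝓝 0)) :
    Tendsto (fun P => ((2 * r * (Real.log P / 2 - b P) * (1 - κ P) - Real.log 2) / 3 - 1) /
      (r / 2 * Real.log P)) atTop (𝓝 (2 / 3)) := by
  have hlog : Tendsto (fun P => (Real.log P)⁻¹) atTop (𝓝 0) :=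
    tendsto_inv_atTop_zero.comp Real.tendsto_log_atTop
  have h1 : Tendsto (fun P => 2 / 3 * (1 - 2 * (b P / Real.log P)) * (1 - κ P) -
      (2 / r * (Real.log 2 / 3 + 1)) * (Real.log P)⁻¹) atTop
      (𝓝 (2 / 3 * (1 - 2 * 0) * (1 - 0) - (2 / r * (Real.log 2 / 3 + 1)) * 0)) :=
    (((tendsto_const_nhds.sub (hb.const_mul 2)).const_mul (2 / 3)).mul
      (tendsto_const_nhds.sub hκ)).sub (hlog.const_mul _)
  have h2 : (2 / 3 * (1 - 2 * 0) * (1 - 0) - (2 / r * (Real.log 2 / 3 + 1)) * 0 : ℝ) = 2 / 3 := by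
    ring
  rw [h2] at h1
  refine h1.congr' ?_
  filter_upwards [Real.tendsto_log_atTop.eventually_gt_atTop 0] with P hP
  field_simp
  ring

/-- Level `j` has a fixed spacing `Δ j` and works for almost every channel from some level on, so
it remains to let the level tend to infinity slowly with the power. -/
theorem achievesDoF_isBeamformed {Ω : Type*} [MeasurableSpace Ω] (μ : Measure Ω)
    [IsProbabilityMeasure μ] (h : Fin 2 → ℕ → Ω → Fin 2 → 𝕜) (hh : IsGenericBlockFading μ h) :
    AchievesDoF μ h IsBeamformed (fun _ => 2 / 3) := by
  obtain ⟨C, hC, hnoise⟩ := exists_tendsto_noise_energy 𝕜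
  -- At level `j` the outer code corrects a fraction of order `κ j`: a fraction `κ j / 2` of nearly
  -- singular supersymbols and, counted twice, a fraction `κ j / 4` of noisy ones.
  let κ : ℕ → ℝ := fun j => (1 / 2) ^ j
  have hκ0 : ∀ j, 0 < κ j := fun j => by positivity
  have hκ1 : ∀ j, κ j ≤ 1 := fun j => pow_le_one₀ (by norm_num) (by norm_num)
  obtain ⟨s, hs, hfew⟩ := exists_eventually_few_nearSingular μ h hh (fun j => κ j / 4)
    fun j => by have := hκ0 j; positivity
  let r : ℝ := Module.finrank ℝ 𝕜
  have hr : 0 < r := by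
    have : 0 < Module.finrank ℝ 𝕜 := Module.finrank_pos
    exact Nat.cast_pos.2 this
  let θ : ℕ → ℝ := fun j => 10 * C / (κ j / 4)
  have hθ : ∀ j, 0 < θ j := fun j => by have := hκ0 j; positivity
  -- Points at distance `Δ j` stay more than `2 * √(θ j)` apart at the receiver.
  let Δ : ℕ → ℝ := fun j => 3 * √(θ j) / s j
  have hΔ : ∀ j, 0 < Δ j := fun j => by
    have := hs j; have := Real.sqrt_pos.2 (hθ j); positivity
  have hsΔ : ∀ j, 2 * √(θ j) < s j * Δ j := fun j => by
    have := Real.sqrt_pos.2 (hθ j)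
    have h1 : s j * Δ j = 3 * √(θ j) := mul_div_cancel₀ _ (hs j).ne'
    rw [h1]; linarith
  obtain ⟨J, hJ, hJlog⟩ := exists_slow_index fun j => Real.log (3 * r * Δ j)
  -- With `q + 1` levels spaced by `Δ` the superposed points respect the power `P`; rounding
  -- down leaves the single point `0` when `P` is small.
  let q : ℝ → ℕ := fun P => ⌊√P / (3 * r * Δ (J P))⌋₊
  have hden : ∀ P, 0 < 3 * r * Δ (J P) := fun P => by have := hΔ (J P); positivity
  choose M c hM hnorm hdist hcard using fun (P : ℝ) (n : ℕ) =>
    exists_codebook 𝕜 (q P) (n / 3) (hκ0 (J P)).le (hΔ (J P)).le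
  refine ⟨fun _ P => (2 * r * (Real.log P / 2 - Real.log (3 * r * Δ (J P))) * (1 - κ (J P)) -
      Real.log 2) / 3 - 1, fun P n => beamformedCode n (hM P n) (c P n) (θ (J P)), ?_, ?_, ?_, ?_⟩
  · intro k
    exact tendsto_rate hr hJlog
      ((tendsto_pow_atTop_nhds_zero_of_lt_one (by norm_num) (by norm_num)).comp hJ)
  · intro P hP n
    refine ⟨isBeamformed_beamformedCode, powerConstraint_beamformedCode (hnorm P n) ?_⟩
    have h1 : (q P : ℝ) ≤ √P / (3 * r * Δ (J P)) := Nat.floor_le (by have := hden P; positivity)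
    rw [le_div_iff₀ (hden P)] at h1
    have h0 : 0 ≤ Δ (J P) * (r * q P) := by have := hΔ (J P); positivity
    have h2 : Δ (J P) * (r * q P) ≤ √P / 3 := by linarith
    have h3 := pow_le_pow_left₀ h0 h2 2
    rw [div_pow, Real.sq_sqrt hP.le] at h3
    change 8 * (Δ (J P) * (r * q P)) ^ 2 ≤ P
    linarith
  · intro P hP k
    refine eventually_exp_rate_le (hM P) fun n => le_trans ?_ (hcard P n)
    have h1 : Real.log P / 2 - Real.log (3 * r * Δ (J P)) ≤ Real.log (q P + 1 : ℕ) := by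
      rw [← Real.log_sqrt hP.le, ← Real.log_div (Real.sqrt_pos.2 hP).ne' (hden P).ne']
      refine Real.log_le_log (div_pos (Real.sqrt_pos.2 hP) (hden P)) ?_
      push_cast
      exact (Nat.lt_floor_add_one _).le
    have h2 : 0 ≤ 1 - κ (J P) := sub_nonneg.2 (hκ1 (J P))
    change _ ≤ _ * (2 * r * _ * _ - _)
    gcongr
  · filter_upwards [hfew] with ω hω
    filter_upwards [hJ.eventually hω] with P hP k
    refine squeeze_zero' (Eventually.of_forall fun n => ?_) ?_ hnoise
    · exact div_nonneg (Finset.sum_nonneg fun _ _ => measureReal_nonneg) (Nat.cast_nonneg _)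
    · filter_upwards [eventually_ge_atTop 3] with n hn
      refine errorProb_beamformedCode_le hn (hs _) (by have := hκ0 (J P); positivity) hC rfl
        (hsΔ (J P)) ?_ (hP k)
      intro m m' hm
      have := hdist P n m m' hm
      rwa [mul_div_cancel₀ _ (by norm_num : (4 : ℝ) ≠ 0)]

end
end StaggeredBC

theorem theorem2 {𝕜 : Type*} [RCLike 𝕜] {Ω : Type*} [MeasurableSpace Ω]
    (μ : MeasureTheory.Measure Ω) [MeasureTheory.IsProbabilityMeasure μ]
    (h : Fin 2 → ℕ → Ω → Fin 2 → 𝕜) (hh : StaggeredBC.IsGenericBlockFading μ h) :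
    StaggeredBC.AchievesTotalDoF μ h (4 / 3) ∧
      StaggeredBC.AchievesDoF μ h StaggeredBC.IsBeamformed (fun _ => 2 / 3) := by
  have hB := StaggeredBC.achievesDoF_isBeamformed μ h hh
  refine ⟨⟨fun _ => 2 / 3, ?_, by norm_num⟩, hB⟩
  obtain ⟨R, C, hR, hC, hcard, herr⟩ := hB
  exact ⟨R, C, hR, fun P hP n => ⟨trivial, (hC P hP n).2⟩, hcard, herr⟩
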